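/- Let $A\in\{0,\star\}^{d\times d}$ and $B\in\{0,\star\}^{d\times m}$ be sparsity matrices, where $0$ denotes a fixed zero and $\star$ a free parameter. A numerical realisation of such a pair is a pair of real matrices obtained by assigning real values to the $\star$ entries. A pair of sparsity matrices is \emph{structurally controllable} if at least one of its numerical realisations $(A',B')$ is controllable, i.e. every initial state of $\dot x=A'x+B'u$ can be steered to every final state in finite time. Assume that $(A,B)$ is structurally controllable, and let a cost $w_{ij}\ge 0$ be given for every $(i,j)$ with $B_{ij}=\star$. Let $$\mathcal K=\{B'\in\{0,\star\}^{d\times m} : B'_{ij}=0 \text{ whenever } B_{ij}=0,\ (A,B') \text{ is structurally controllable}\},$$ and put $\|B'\|_w=\sum_{(i,j):\,B'_{ij}\ne 0} w_{ij}$ for such $B'$. The problem $(\mathcal P_1)$ is to minimise $\|B'\|_w$ over $B'\in\mathcal K$. Suppose that the digraph $G(A)$ on the state vertices $v_1,\dots,v_d$, with an edge from $v_j$ to $v_i$ whenever $A_{ij}\neq 0$, is a directed tree rooted at some state vertex $v_r$, meaning that $G(A)$ has no directed cycle (in particular no loop) and that there is a directed path from $v_r$ to every vertex. Consider the following algorithm.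 Form the bipartite graph $\Gamma(A,B)$ with sides $\{v_1^1,\dots,v_d^1\}\sqcup\{u_1,\dots,u_m\}$ and $\{v_1^2,\dots,v_d^2\}$, and with the edges $(v_j^1,v_i^2)$ for $A_{ij}\ne 0$, of cost $0$, and $(u_j,v_i^2)$ for $B_{ij}\neq 0$, of cost $w_{ij}$. Find a minimum cost maximum matching $M^*$, that is, a matching whose total cost is least among all matchings of $\Gamma(A,B)$ of maximum cardinality. Return the matrix $B^*\in\{0,\star\}^{d\times m}$ with $B^*_{ij}=\star$ if $(u_j,v_i^2)\in M^*$ and $B^*_{ij}=0$ otherwise. Then such a matching $M^*$ exists, and for every choice of it the matrix $B^*$ returned by the algorithm satisfies $B^*\in\mathcal K$ and solves $(\mathcal P_1)$, i.e. $\|B^*\|_w\le\|B'\|_w$ for all $B'\in\mathcal K$. -/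

import Mathlib

/-- A sparsity matrix in `{0, ⋆}^{n × k}`: the entry `true` stands for the free parameter `⋆`,
the entry `false` for a fixed zero. -/
abbrev SparsityMatrix (n k : ℕ) := Matrix (Fin n) (Fin k) Bool

namespace SparsityMatrix

/-- `R'` is a numerical realisation of `R`: the `⋆` entries get arbitrary real values, the fixed
zeros stay zero. -/
def IsRealisation {n k : ℕ} (R : SparsityMatrix n k) (R' : Matrix (Fin n) (Fin k) ℝ) : Prop :=
  ∀ i j, R i j = false → R' i j = 0

/-- The locations `Z(R)` of the fixed zeros of `R`. -/
def zeroLocations {n k : ℕ} (R : SparsityMatrix n k) : Set (Fin n × Fin k) :=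
  {p | R p.1 p.2 = false}

/-- `‖N‖_w`, the sum of the costs `w i j` over the nonzero entries of `N`. -/
def weightedNorm {n k : ℕ} (w : Matrix (Fin n) (Fin k) ℝ) (N : SparsityMatrix n k) : ℝ :=
  ∑ i, ∑ j, w i j * (if N i j = true then 1 else 0)

end SparsityMatrix

/-- Controllability of the system `x' = A x + B u`: every initial state can be steered to every
final state in finite time, by a continuous input. -/
def IsControllable {d m : ℕ} (A : Matrix (Fin d) (Fin d) ℝ) (B : Matrix (Fin d) (Fin m) ℝ) :
    Prop :=
  ∀ x₀ x₁ : Fin d → ℝ, ∃ T : ℝ, 0 < T ∧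
    ∃ (u : ℝ → Fin m → ℝ) (x : ℝ → Fin d → ℝ),
      ContinuousOn u (Set.Icc 0 T) ∧
      (∀ t ∈ Set.Icc 0 T,
        HasDerivWithinAt x (A.mulVec (x t) + B.mulVec (u t)) (Set.Icc 0 T) t) ∧
      x 0 = x₀ ∧ x T = x₁

/-- A pair of sparsity matrices is structurally controllable if some numerical realisation of it
is controllable. -/
def IsStructurallyControllable {d m : ℕ} (A : SparsityMatrix d d) (B : SparsityMatrix d m) :
    Prop :=
  ∃ (A' : Matrix (Fin d) (Fin d) ℝ) (B' : Matrix (Fin d) (Fin m) ℝ),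
    A.IsRealisation A' ∧ B.IsRealisation B' ∧ IsControllable A' B'

/-- The set `𝒦` of admissible input matrices. -/
def admissibleInputs {d m : ℕ} (A : SparsityMatrix d d) (B : SparsityMatrix d m) :
    Set (SparsityMatrix d m) :=
  {B' | B.zeroLocations ⊆ B'.zeroLocations ∧ IsStructurallyControllable A B'}

/-- `Bs` solves the problem of minimising `‖B'‖_w` over the admissible input matrices `B'`. -/
def SolvesMinCost {d m : ℕ} (A : SparsityMatrix d d) (B : SparsityMatrix d m)
    (w : Matrix (Fin d) (Fin m) ℝ) (Bs : SparsityMatrix d m) : Prop :=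
  Bs ∈ admissibleInputs A B ∧
    ∀ B' ∈ admissibleInputs A B, Bs.weightedNorm w ≤ B'.weightedNorm w

/-- The state digraph `G(A)`, with an edge from `v_j` to `v_i` whenever `A i j ≠ 0`. -/
def stateDigraph {d : ℕ} (A : SparsityMatrix d d) : Digraph (Fin d) where
  Adj j i := A i j = true

/-- `G` is a directed tree rooted at `r`: it is acyclic (no closed walk of positive length, in
particular no loop), and `r` has a directed path to every vertex. -/
def IsDirectedTreeRootedAt {V : Type*} (G : Digraph V) (r : V) : Prop :=
  (∀ v, ¬ Relation.TransGen G.Adj v v) ∧ ∀ v, Relation.ReflTransGen G.Adj r v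

section Bipartite

/-! A finite bipartite graph with sides `L` and `R` is given by its edge set `E ⊆ L × R`. -/

variable {L R : Type*}

/-- `M` is a matching: a set of edges of which no two share a vertex. -/
def IsMatchingIn (E M : Finset (L × R)) : Prop :=
  M ⊆ E ∧ ∀ e ∈ M, ∀ f ∈ M, e ≠ f → e.1 ≠ f.1 ∧ e.2 ≠ f.2

/-- `M` is a matching with the maximum number of edges. -/
def IsMaximumMatchingIn (E M : Finset (L × R)) : Prop :=
  IsMatchingIn E M ∧ ∀ N, IsMatchingIn E N → N.card ≤ M.card

/-- `M` is a minimum cost maximum matching for the edge costs `c`. -/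
def IsMinCostMaximumMatchingIn (E : Finset (L × R)) (c : L × R → ℝ) (M : Finset (L × R)) : Prop :=
  IsMaximumMatchingIn E M ∧ ∀ N, IsMaximumMatchingIn E N → ∑ e ∈ M, c e ≤ ∑ e ∈ N, c e

end Bipartite

/-- Edge set of the bipartite graph `Γ(A, B)` with sides `V_A¹ ⊔ V_B` and `V_A²`: the edges
`(v_j¹, v_i²)` with `A i j ≠ 0` and the edges `(u_j, v_i²)` with `B i j ≠ 0`. -/
def bipartiteEdges {d m : ℕ} (A : SparsityMatrix d d) (B : SparsityMatrix d m) :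
    Finset ((Fin d ⊕ Fin m) × Fin d) :=
  Finset.univ.filter fun e => Sum.elim (fun j => A e.2 j) (fun j => B e.2 j) e.1 = true

/-- The edge costs on `Γ(A, B)`: state edges are free, and `(u_j, v_i²)` costs `w i j`. -/
def edgeCost {d m : ℕ} (w : Matrix (Fin d) (Fin m) ℝ) (e : (Fin d ⊕ Fin m) × Fin d) : ℝ :=
  Sum.elim (fun _ => 0) (fun j => w e.2 j) e.1

/-- The input matrix whose `⋆` entries are the positions `(i, j)` with `(u_j, v_i²) ∈ M`. -/
def inputMatrixOfMatching {d m : ℕ} (M : Finset ((Fin d ⊕ Fin m) × Fin d)) : SparsityMatrix d m :=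
  fun i j => decide ((Sum.inr j, i) ∈ M)

/-- `Bs` is a possible output of the matching algorithm on input `A`, `B` with costs `w`: build
`Γ(A, B)` with its edge costs, find some minimum cost maximum matching `M`, and return the input
matrix given by the input edges of `M`. -/
def IsMatchingAlgorithmOutput {d m : ℕ} (A : SparsityMatrix d d) (B : SparsityMatrix d m)
    (w : Matrix (Fin d) (Fin m) ℝ) (Bs : SparsityMatrix d m) : Prop :=
  ∃ M, IsMinCostMaximumMatchingIn (bipartiteEdges A B) (edgeCost w) M ∧
    Bs = inputMatrixOfMatching M

/-! Everything reduces to matchings of `Γ(A, B)` that saturate the state side. Necessity: a row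
vector annihilating `[A B]` would give a conserved quantity, so controllability makes the rows
independent, and Hall's theorem matches rows to distinct nonzero columns. Sufficiency: when `G(A)`
is acyclic, a saturating matching splits the states into chains of integrators, each fed by its own
input. Setting matched entries to 1 and all others to 0, the last state of a chain is a polynomial
whose derivatives are the other states, so Hermite interpolation steers the system in time 1. Hence
the maximum matchings of `Γ(A, B)` are the saturating ones, and each yields an element of `𝒦` whose
norm is the matching cost. Conversely every `B' ∈ 𝒦` contains a saturating matching, of cost at most
`‖B'‖_w` because `w ≥ 0`; so the minima agree. -/

/-! ### Two-point Hermite interpolation -/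

open Polynomial in
/-- A polynomial with prescribed derivatives at a point. -/
theorem exists_polynomial_iterate_derivative_eval (c : ℝ) (a : ℕ → ℝ) (N : ℕ) :
    ∃ p : ℝ[X], ∀ k < N, (derivative^[k] p).eval c = a k := by
  induction N with
  | zero => exact ⟨0, by simp⟩
  | succ N ih =>
    obtain ⟨p, hp⟩ := ih
    -- A multiple of `(X - c)^N` leaves the derivatives of order below `N` at `c` unchanged; its
    -- `N`-th derivative carries the factor `N!`.
    refine ⟨p + C ((a N - (derivative^[N] p).eval c) / (N.factorial : ℝ)) * (X - C c) ^ N,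
      fun k hk => ?_⟩
    have hN : (N.factorial : ℝ) ≠ 0 := by exact_mod_cast N.factorial_ne_zero
    rw [iterate_map_add, iterate_derivative_C_mul, iterate_derivative_X_sub_pow]
    rcases Nat.lt_succ_iff_lt_or_eq.mp hk with h | rfl
    · simp [hp k h, (Nat.sub_pos_of_lt h).ne']
    · simp [Nat.descFactorial_self]
      field_simp
      ring

open Polynomial in
/-- Hermite interpolation at the two points `0` and `1`. -/
theorem exists_polynomial_hermite (a b : ℕ → ℝ) (N : ℕ) :
    ∃ p : ℝ[X], ∀ k < N,
      (derivative^[k] p).eval 0 = a k ∧ (derivative^[k] p).eval 1 = b k := by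
  obtain ⟨p, hp⟩ := exists_polynomial_iterate_derivative_eval 0 a N
  obtain ⟨q, hq⟩ := exists_polynomial_iterate_derivative_eval 1 b N
  have hcop : IsCoprime ((X - C (0 : ℝ)) ^ N) ((X - C (1 : ℝ)) ^ N) :=
    (isCoprime_X_sub_C_of_isUnit_sub (by simp)).pow
  obtain ⟨s, t, hst⟩ := hcop
  have key : ∀ (c : ℝ) (g : ℝ[X]), (X - C c) ^ N ∣ g → ∀ k < N,
      (derivative^[k] g).eval c = 0 := by
    intro c g hg k hk
    have h := (dvd_pow_self (X - C c) (Nat.sub_pos_of_lt hk).ne').trans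
      (pow_sub_dvd_iterate_derivative_of_pow_dvd k hg)
    exact dvd_iff_isRoot.mp h
  -- By the Bézout identity this is `p` modulo `X^N` and `q` modulo `(X - 1)^N`.
  refine ⟨p + s * (X - C 0) ^ N * (q - p), fun k hk => ⟨?_, ?_⟩⟩
  · rw [iterate_map_add, eval_add, hp k hk,
      key 0 _ ⟨s * (q - p), by ring⟩ k hk, add_zero]
  · have : p + s * (X - C 0) ^ N * (q - p) = q + t * (X - C 1) ^ N * (p - q) := by
      linear_combination (q - p) * hst
    rw [this, iterate_map_add, eval_add, hq k hk,
      key 1 _ ⟨t * (p - q), by ring⟩ k hk, add_zero]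

/-! ### Chains of integrators -/

/-- In an acyclic family of disjoint chains, every element is determined by the last element of
its chain and its distance to that element. -/
theorem exists_chain_coordinates {V W : Type*} (f : V → V ⊕ W) (hf : Function.Injective f)
    (hwf : WellFounded fun c i => f c = Sum.inl i) :
    ∃ g : V → V × ℕ, Function.Injective g ∧
      ∀ c i, f c = Sum.inl i → g i = ((g c).1, (g c).2 + 1) := by
  classical
  -- Recursion towards the end of the chain; injectivity of `f` makes the chosen successor the only
  -- one.
  let F : ∀ i : V, (∀ c, f c = Sum.inl i → V × ℕ) → V × ℕ := fun i rec =>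
    if h : ∃ c, f c = Sum.inl i then
      ((rec h.choose h.choose_spec).1, (rec h.choose h.choose_spec).2 + 1)
    else (i, 0)
  let g : V → V × ℕ := hwf.fix F
  have hg : ∀ i, g i = F i fun c _ => g c := fun i => hwf.fix_eq F i
  have hstep : ∀ c i, f c = Sum.inl i → g i = ((g c).1, (g c).2 + 1) := by
    intro c i hc
    have h : ∃ c, f c = Sum.inl i := ⟨c, hc⟩
    have hcc : h.choose = c := hf (h.choose_spec.trans hc.symm)
    rw [hg i]
    simp only [F, dif_pos h, hcc]
  have hlast : ∀ i, (¬ ∃ c, f c = Sum.inl i) → g i = (i, 0) := by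
    intro i h
    rw [hg i]
    simp only [F, dif_neg h]
  refine ⟨g, fun i => ?_, hstep⟩
  induction i using hwf.induction with
  | _ i ih =>
    intro j hij
    by_cases hi : ∃ c, f c = Sum.inl i <;> by_cases hj : ∃ c, f c = Sum.inl j
    · obtain ⟨c, hc⟩ := hi
      obtain ⟨e, he⟩ := hj
      rw [hstep c i hc, hstep e j he] at hij
      have hce : c = e := ih c hc (Prod.ext (Prod.ext_iff.mp hij).1
        (Nat.succ_injective (Prod.ext_iff.mp hij).2))
      subst hce
      exact Sum.inl_injective (hc.symm.trans he)
    · obtain ⟨c, hc⟩ := hi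
      rw [hstep c i hc, hlast j hj] at hij
      simp at hij
    · obtain ⟨c, hc⟩ := hj
      rw [hstep c j hc, hlast i hi] at hij
      simp at hij
    · rw [hlast i hi, hlast j hj] at hij
      exact (Prod.ext_iff.mp hij).1

open Polynomial in
/-- Disjoint chains of integrators, each driven by its own input, are controllable. -/
theorem isControllable_of_chains {d m : ℕ} (f : Fin d → Fin d ⊕ Fin m)
    (hf : Function.Injective f) (hwf : WellFounded fun c i => f c = Sum.inl i) :
    IsControllable (Matrix.of fun i j => if f i = Sum.inl j then 1 else 0)
      (Matrix.of fun i j => if f i = Sum.inr j then 1 else 0) := by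
  intro x₀ x₁
  obtain ⟨g, hg, hstep⟩ := exists_chain_coordinates f hf hwf
  let N := Finset.univ.sup (fun i => (g i).2) + 1
  have hN : ∀ i, (g i).2 < N := fun i =>
    Nat.lt_succ_of_le (Finset.le_sup (f := fun i => (g i).2) (Finset.mem_univ i))
  -- The data prescribed for the `k`-th derivative of `p l` is the state at distance `k` from `l`;
  -- pairs outside the range of `g` get the harmless value 0.
  choose p hp using fun l : Fin d => exists_polynomial_hermite
    (fun k => Function.extend g x₀ 0 (l, k)) (fun k => Function.extend g x₁ 0 (l, k)) N
  let P : Fin d → ℝ[X] := fun i => derivative^[(g i).2] (p (g i).1)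
  have hP : ∀ c i, f c = Sum.inl i → P i = derivative (P c) := by
    intro c i hc
    simp only [P, hstep c i hc, Function.iterate_succ_apply']
  have hP0 : ∀ i, (P i).eval 0 = x₀ i := fun i =>
    ((hp (g i).1 (g i).2 (hN i)).1).trans (hg.extend_apply x₀ 0 i)
  have hP1 : ∀ i, (P i).eval 1 = x₁ i := fun i =>
    ((hp (g i).1 (g i).2 (hN i)).2).trans (hg.extend_apply x₁ 0 i)
  refine ⟨1, one_pos, fun t j => ∑ i, if f i = Sum.inr j then (derivative (P i)).eval t else 0,
    fun t i => (P i).eval t, ?_, ?_, funext hP0, funext hP1⟩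
  · refine Continuous.continuousOn (continuous_pi fun j => continuous_finsetSum _ fun i _ => ?_)
    split_ifs
    · exact (derivative (P i)).continuous
    · exact continuous_const
  · intro t _
    refine (hasDerivAt_pi.mpr fun i => ?_).hasDerivWithinAt
    have hd := (P i).hasDerivAt t
    refine hd.congr_deriv ?_
    rcases hfi : f i with j | j
    · simp [Matrix.mulVec, dotProduct, hfi, hP i j hfi]
    -- Input `j` drives only state `i`, so the sum defining `u j` has a single term.
    · have : ∀ k, f k = Sum.inr j ↔ k = i := fun k => by rw [← hfi, hf.eq_iff]
      simp [Matrix.mulVec, dotProduct, hfi, this]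

/-! ### Necessity: from controllability to a saturating matching -/

/-- The rows of `[A B]` are linearly independent if the pair `(A, B)` is controllable. -/
theorem IsControllable.linearIndependent_fromCols {d m : ℕ} {A : Matrix (Fin d) (Fin d) ℝ}
    {B : Matrix (Fin d) (Fin m) ℝ} (h : IsControllable A B) :
    LinearIndependent ℝ (Matrix.fromCols A B).row := by
  rw [Fintype.linearIndependent_iff]
  intro v hv
  have hA : Matrix.vecMul v A = 0 := by
    ext j
    simpa [Matrix.vecMul, dotProduct] using congrFun hv (Sum.inl j)
  have hB : Matrix.vecMul v B = 0 := by
    ext j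
    simpa [Matrix.vecMul, dotProduct] using congrFun hv (Sum.inr j)
  -- `v ⬝ᵥ x` is constant along trajectories, and every `x₁` is reached from 0.
  have hconst : ∀ x₁ : Fin d → ℝ, v ⬝ᵥ x₁ = 0 := by
    intro x₁
    obtain ⟨T, hT, u, x, -, hx, h0, h1⟩ := h 0 x₁
    have hderiv : ∀ t ∈ Set.Icc 0 T,
        HasDerivWithinAt (fun t => v ⬝ᵥ x t) 0 (Set.Icc 0 T) t := by
      intro t ht
      have h2 := HasDerivWithinAt.fun_sum (u := Finset.univ) fun i _ =>
        (hasDerivWithinAt_pi.mp (hx t ht) i).const_mul (v i)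
      have h3 : ∑ i, v i * (A.mulVec (x t) + B.mulVec (u t)) i = 0 := by
        change v ⬝ᵥ (A.mulVec (x t) + B.mulVec (u t)) = 0
        rw [dotProduct_add, Matrix.dotProduct_mulVec, Matrix.dotProduct_mulVec, hA, hB]
        simp
      rw [h3] at h2
      exact h2
    have := constant_of_derivWithin_zero (fun t ht => (hderiv t ht).differentiableWithinAt)
      (fun t ht => (hderiv t (Set.Ico_subset_Icc_self ht)).derivWithin
        (uniqueDiffOn_Icc hT t (Set.Ico_subset_Icc_self ht))) T (Set.right_mem_Icc.mpr hT.le)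
    simpa [h0, h1] using this
  intro i
  simpa using hconst (Pi.single i 1)

/-- If a matrix has linearly independent rows, then its rows can be matched injectively to columns
with nonzero entries. -/
theorem LinearIndependent.exists_injective_ne_zero {K ι κ : Type*} [Field K] [Fintype ι]
    [Fintype κ] {M : Matrix ι κ K} (h : LinearIndependent K M.row) :
    ∃ f : ι → κ, Function.Injective f ∧ ∀ i, M i (f i) ≠ 0 := by
  classical
  have hall := (Finset.all_card_le_biUnion_card_iff_exists_injective
    fun i => Finset.univ.filter fun j => M i j ≠ 0).mp ?_
  · simpa using hall
  intro s
  set t := s.biUnion fun i => Finset.univ.filter fun j => M i j ≠ 0 with ht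
  -- The rows in `s` vanish outside `t`, so they stay independent in `K^t`; this gives Hall's
  -- condition `|s| ≤ |t|`.
  have hli : LinearIndependent K fun (i : s) (j : t) => M i j := by
    rw [Fintype.linearIndependent_iff]
    intro v hv
    have hs := Fintype.linearIndependent_iff.mp (h.comp ((↑) : s → ι) Subtype.val_injective) v
    simp only [Function.comp_apply] at hs
    apply hs
    ext j
    by_cases hj : j ∈ t
    · simpa using congrFun hv ⟨j, hj⟩
    · have : ∀ i : s, M i j = 0 := fun i => by
        by_contra hne
        exact hj (Finset.mem_biUnion.mpr ⟨i, i.2, by simpa using hne⟩)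
      simp [this]
  simpa using hli.fintype_card_le_finrank

/-! ### Matchings saturating the right side -/

section PerfectMatching

variable {L R : Type*}

theorem IsMatchingIn.injOn_snd {E M : Finset (L × R)} (h : IsMatchingIn E M) :
    Set.InjOn Prod.snd (M : Set (L × R)) := fun e he e' he' hs => by
  by_contra hne
  exact (h.2 e he e' he' hne).2 hs

theorem IsMatchingIn.card_le [Fintype R] {E M : Finset (L × R)} (h : IsMatchingIn E M) :
    M.card ≤ Fintype.card R := by
  classical
  rw [← Finset.card_image_of_injOn h.injOn_snd]
  exact Finset.card_le_univ _

variable [Fintype R] [DecidableEq L] [DecidableEq R]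

/-- The matching that saturates the right side and pairs `i` with `f i`. -/
def matchingOfFun (f : R → L) : Finset (L × R) :=
  Finset.univ.image fun i => (f i, i)

theorem mem_matchingOfFun {f : R → L} {l : L} {i : R} : (l, i) ∈ matchingOfFun f ↔ f i = l := by
  simp only [matchingOfFun, Finset.mem_image, Finset.mem_univ, true_and, Prod.mk.injEq]
  exact ⟨fun ⟨_, h, h'⟩ => h' ▸ h, fun h => ⟨i, h, rfl⟩⟩

theorem card_matchingOfFun (f : R → L) : (matchingOfFun f).card = Fintype.card R :=
  Finset.card_image_of_injective _ fun _ _ h => (Prod.ext_iff.mp h).2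

theorem sum_matchingOfFun (f : R → L) (c : L × R → ℝ) :
    ∑ e ∈ matchingOfFun f, c e = ∑ i, c (f i, i) :=
  Finset.sum_image fun _ _ _ _ h => (Prod.ext_iff.mp h).2

theorem isMatchingIn_matchingOfFun {E : Finset (L × R)} {f : R → L} (hf : Function.Injective f)
    (hE : ∀ i, (f i, i) ∈ E) : IsMatchingIn E (matchingOfFun f) := by
  refine ⟨fun e he => ?_, fun e he e' he' hne => ?_⟩
  · obtain ⟨i, -, rfl⟩ := Finset.mem_image.mp he
    exact hE i
  · obtain ⟨i, -, rfl⟩ := Finset.mem_image.mp he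
    obtain ⟨j, -, rfl⟩ := Finset.mem_image.mp he'
    have : i ≠ j := fun h => hne (by rw [h])
    exact ⟨hf.ne this, this⟩

theorem isMaximumMatchingIn_matchingOfFun {E : Finset (L × R)} {f : R → L}
    (hf : Function.Injective f) (hE : ∀ i, (f i, i) ∈ E) :
    IsMaximumMatchingIn E (matchingOfFun f) :=
  ⟨isMatchingIn_matchingOfFun hf hE, fun _ hN => (card_matchingOfFun f).symm ▸ hN.card_le⟩

theorem IsMatchingIn.exists_eq_matchingOfFun {E M : Finset (L × R)} (h : IsMatchingIn E M)
    (hcard : Fintype.card R ≤ M.card) :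
    ∃ f : R → L, Function.Injective f ∧ (∀ i, (f i, i) ∈ E) ∧ M = matchingOfFun f := by
  have himg : M.image Prod.snd = Finset.univ := by
    apply Finset.eq_univ_of_card
    rw [Finset.card_image_of_injOn h.injOn_snd]
    exact le_antisymm h.card_le hcard
  have hex : ∀ i : R, ∃ l : L, (l, i) ∈ M := fun i => by
    have hi : i ∈ M.image Prod.snd := himg ▸ Finset.mem_univ i
    simpa using hi
  choose f hfM using hex
  refine ⟨f, fun i j hij => ?_, fun i => h.1 (hfM i), ?_⟩
  · by_contra hne
    exact (h.2 _ (hfM i) _ (hfM j) fun he => hne (Prod.ext_iff.mp he).2).1 hij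
  · refine (Finset.eq_of_subset_of_card_le (fun e he => ?_) ?_).symm
    · obtain ⟨i, -, rfl⟩ := Finset.mem_image.mp he
      exact hfM i
    · rw [card_matchingOfFun]
      exact h.card_le

end PerfectMatching

theorem exists_isMinCostMaximumMatchingIn {L R : Type*} (E : Finset (L × R)) (c : L × R → ℝ) :
    ∃ M, IsMinCostMaximumMatchingIn E c M := by
  classical
  obtain ⟨M₀, hM₀, hmax⟩ := (E.powerset.filter (IsMatchingIn E)).exists_max_image Finset.card
    ⟨∅, by simp [IsMatchingIn]⟩
  have hM₀' : IsMaximumMatchingIn E M₀ := ⟨(Finset.mem_filter.mp hM₀).2, fun N hN =>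
    hmax N (Finset.mem_filter.mpr ⟨Finset.mem_powerset.mpr hN.1, hN⟩)⟩
  obtain ⟨M, hM, hmin⟩ := (E.powerset.filter (IsMaximumMatchingIn E)).exists_min_image
    (fun M => ∑ e ∈ M, c e)
    ⟨M₀, Finset.mem_filter.mpr ⟨Finset.mem_powerset.mpr hM₀'.1.1, hM₀'⟩⟩
  exact ⟨M, (Finset.mem_filter.mp hM).2, fun N hN =>
    hmin N (Finset.mem_filter.mpr ⟨Finset.mem_powerset.mpr hN.1.1, hN⟩)⟩

/-! ### Optimality of the matching algorithm -/

/-- The bipartite graph of a structurally controllable pair has a matching that saturates the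
right side. -/
theorem IsStructurallyControllable.exists_injective {d m : ℕ} {A : SparsityMatrix d d}
    {B : SparsityMatrix d m} (h : IsStructurallyControllable A B) :
    ∃ f : Fin d → Fin d ⊕ Fin m, Function.Injective f ∧ ∀ i, (f i, i) ∈ bipartiteEdges A B := by
  obtain ⟨A', B', hA', hB', hc⟩ := h
  obtain ⟨f, hf, hne⟩ := hc.linearIndependent_fromCols.exists_injective_ne_zero
  refine ⟨f, hf, fun i => ?_⟩
  have hi := hne i
  rcases hfi : f i with j | j <;> rw [hfi] at hi
  · simpa [bipartiteEdges] using fun h0 => hi (hA' i j h0)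
  · simpa [bipartiteEdges] using fun h0 => hi (hB' i j h0)

/-- If `G(A)` is acyclic, then a matching that saturates the right side consists of disjoint
chains, and its input edges make `A` structurally controllable. -/
theorem isStructurallyControllable_inputMatrixOfMatching {d m : ℕ} {A : SparsityMatrix d d}
    {B : SparsityMatrix d m} (hA : ∀ v, ¬ Relation.TransGen (stateDigraph A).Adj v v)
    {f : Fin d → Fin d ⊕ Fin m} (hf : Function.Injective f)
    (hE : ∀ i, (f i, i) ∈ bipartiteEdges A B) :
    IsStructurallyControllable A (inputMatrixOfMatching (matchingOfFun f)) := by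
  have hedge : ∀ c i, f c = Sum.inl i → (stateDigraph A).Adj i c := by
    intro c i hc
    have := hE c
    rw [hc] at this
    simpa [bipartiteEdges, stateDigraph] using this
  have hwf : WellFounded fun c i => f c = Sum.inl i := by
    -- Reversed reachability is a strict order on a finite set, hence well-founded.
    let T : Fin d → Fin d → Prop := fun c i => Relation.TransGen (stateDigraph A).Adj i c
    have : IsTrans (Fin d) T := ⟨fun _ _ _ h h' => Relation.TransGen.trans h' h⟩
    have : Std.Irrefl T := ⟨hA⟩
    exact Subrelation.wf (fun {c i} h => Relation.TransGen.single (hedge c i h))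
      (Finite.wellFounded_of_trans_of_irrefl T)
  refine ⟨_, _, fun i j hij => ?_, fun i j hij => ?_, isControllable_of_chains f hf hwf⟩
  · refine if_neg fun h => ?_
    have h' : A i j = true := hedge i j h
    simp [h'] at hij
  · refine if_neg fun h => ?_
    simp [inputMatrixOfMatching, mem_matchingOfFun, h] at hij

theorem weightedNorm_inputMatrixOfMatching {d m : ℕ} (w : Matrix (Fin d) (Fin m) ℝ)
    (f : Fin d → Fin d ⊕ Fin m) :
    (inputMatrixOfMatching (matchingOfFun f)).weightedNorm w = ∑ i, edgeCost w (f i, i) := by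
  refine Finset.sum_congr rfl fun i _ => ?_
  rcases hfi : f i with j | j <;>
    simp [inputMatrixOfMatching, mem_matchingOfFun, edgeCost, hfi]

/-- The matching uses at most one entry of `B` in each row, and the remaining terms of that row are
nonnegative. -/
theorem sum_edgeCost_le_weightedNorm {d m : ℕ} {A : SparsityMatrix d d} {B : SparsityMatrix d m}
    {w : Matrix (Fin d) (Fin m) ℝ} (hw : ∀ i j, B i j = true → 0 ≤ w i j)
    {f : Fin d → Fin d ⊕ Fin m} (hE : ∀ i, (f i, i) ∈ bipartiteEdges A B) :
    ∑ i, edgeCost w (f i, i) ≤ B.weightedNorm w := by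
  refine Finset.sum_le_sum fun i _ => ?_
  have hnn : ∀ j ∈ Finset.univ, 0 ≤ w i j * (if B i j = true then 1 else 0) := fun j _ => by
    split_ifs with h
    · simpa using hw i j h
    · simp
  rcases hfi : f i with j | j
  · simpa [edgeCost] using Finset.sum_nonneg hnn
  · have hB : B i j = true := by
      have := hE i
      rw [hfi] at this
      simpa [bipartiteEdges] using this
    simpa [edgeCost, hB] using Finset.single_le_sum hnn (Finset.mem_univ j)

theorem mainTheorem6 {d m : ℕ} (A : SparsityMatrix d d) (B : SparsityMatrix d m)
    (hAB : IsStructurallyControllable A B)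
    (w : Matrix (Fin d) (Fin m) ℝ) (hw : ∀ i j, B i j = true → 0 ≤ w i j)
    (r : Fin d) (hA : IsDirectedTreeRootedAt (stateDigraph A) r) :
    (∃ Bs, IsMatchingAlgorithmOutput A B w Bs) ∧
      ∀ Bs, IsMatchingAlgorithmOutput A B w Bs →
        Bs ∈ admissibleInputs A B ∧ SolvesMinCost A B w Bs := by
  refine ⟨?_, ?_⟩
  · obtain ⟨M, hM⟩ := exists_isMinCostMaximumMatchingIn (bipartiteEdges A B) (edgeCost w)
    exact ⟨_, M, hM, rfl⟩
  rintro _ ⟨M, ⟨⟨hM, hmax⟩, hmin⟩, rfl⟩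
  obtain ⟨f₀, hf₀, hE₀⟩ := hAB.exists_injective
  -- The matching from `f₀` has `d` edges, so the maximum matching `M` saturates too.
  obtain ⟨f, hf, hE, rfl⟩ := hM.exists_eq_matchingOfFun
    ((card_matchingOfFun f₀).symm.le.trans (hmax _ (isMatchingIn_matchingOfFun hf₀ hE₀)))
  have hmem : inputMatrixOfMatching (matchingOfFun f) ∈ admissibleInputs A B := by
    refine ⟨?_, isStructurallyControllable_inputMatrixOfMatching hA.1 hf hE⟩
    rintro ⟨i, j⟩ (hij : B i j = false)
    refine decide_eq_false fun h => ?_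
    have := hM.1 h
    simp [bipartiteEdges, hij] at this
  refine ⟨hmem, hmem, fun B' hB' => ?_⟩
  obtain ⟨g, hg, hEg⟩ := hB'.2.exists_injective
  have hle : ∀ i j, B' i j = true → B i j = true := fun i j h => by
    by_contra hne
    have h0 : B' i j = false := hB'.1 (show (i, j) ∈ B.zeroLocations from by
      simpa [SparsityMatrix.zeroLocations] using hne)
    simp [h0] at h
  -- The matching of `Γ(A, B')` lives in the larger graph `Γ(A, B)`, so it competes with the minimum
  -- cost one.
  have hEg' : ∀ i, (g i, i) ∈ bipartiteEdges A B := fun i => by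
    have := hEg i
    rcases hgi : g i with j | j <;> rw [hgi] at this
    · simpa [bipartiteEdges] using this
    · simpa [bipartiteEdges] using hle i j (by simpa [bipartiteEdges] using this)
  have hcost := hmin _ (isMaximumMatchingIn_matchingOfFun hg hEg')
  rw [sum_matchingOfFun, sum_matchingOfFun] at hcost
  rw [weightedNorm_inputMatrixOfMatching]
  exact hcost.trans (sum_edgeCost_le_weightedNorm (fun i j h => hw i j (hle i j h)) hEg)
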